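/- Let $\Bbbk$ be an algebraically closed field of characteristic $0$, and let $P=\Bbbk[x_1,x_2,x_3]$ carry a Poisson bracket that is quadratic ($\{P_1,P_1\}\subseteq P_2$ for the standard grading) and unimodular: there is a homogeneous polynomial $\Omega$ with $$\{x_1,x_2\}=\frac{\partial\Omega}{\partial x_3},\qquad \{x_2,x_3\}=\frac{\partial\Omega}{\partial x_1},\qquad \{x_3,x_1\}=\frac{\partial\Omega}{\partial x_2}.$$ Write $\{x_i,x_j\}=\sum_{k,l}c_{i,j}^{k,l}x_kx_l$ with $c_{i,j}^{k,l}\in\Bbbk$ for $1\le i,j\le 3$, and let $$P_\hbar=\Bbbk[[\hbar]]\langle y_1,y_2,y_3\rangle\Big/\Big([y_i,y_j]=\tfrac{\hbar}{2}\sum_{k,l}c_{i,j}^{k,l}(y_ky_l+y_ly_k)\Big)_{1\le i,j\le 3}$$ be its standard deformation quantization, with $\hbar$ a formal parameter. Let $G$ be a finite group of graded Poisson automorphisms of $P$ (for instance, a finite group generated by Poisson reflections). Every graded Poisson automorphism $\phi$ of $P$, $\phi(x_i)=\sum_j a_{ij}x_j$ with $a_{ij}\in\Bbbk$, determines a graded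 $\Bbbk[[\hbar]]$-algebra automorphism $\phi_\hbar$ of $P_\hbar$ by $\phi_\hbar(y_i)=\sum_j a_{ij}y_j$; let $G_\hbar=\{\phi_\hbar:\phi\in G\}$ and let $Q_\hbar=P_\hbar^{G_\hbar}$ be the subalgebra of invariants. Then: 1. $Q_\hbar/(\hbar)\cong P^G$ as $\Bbbk$-algebras. 2. For all $f,g\in Q_\hbar$ there is $\pi_1(f,g)\in Q_\hbar$ with $fg-gf=\hbar\,\pi_1(f,g)$. 3. The rule $\{\overline f,\overline g\}=\overline{\pi_1(f,g)}$, where $\overline{(\ )}$ denotes the image under $Q_\hbar\to Q_\hbar/(\hbar)$, gives a well-defined Poisson bracket on $Q_\hbar/(\hbar)$, and with this bracket $Q_\hbar/(\hbar)$ is isomorphic to $P^G$, with the bracket restricted from $P$, as Poisson algebras. -/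

import Mathlib

open scoped PowerSeries

noncomputable section

/-- A Poisson algebra structure on a `k`-algebra `A`: the algebra `A` is commutative and carries a
Lie bracket over `k` which is a derivation in its second argument (hence in each argument). -/
structure PoissonStructure (k A : Type*) [CommRing k] [Ring A] [Algebra k A] where
  /-- the Poisson bracket, as a `k`-bilinear map -/
  bracket : A →ₗ[k] A →ₗ[k] A
  mul_comm' : ∀ a b : A, a * b = b * a
  bracket_self : ∀ a, bracket a a = 0
  jacobi : ∀ a b c,
    bracket a (bracket b c) + bracket b (bracket c a) + bracket c (bracket a b) = 0
  leibniz : ∀ a b c, bracket a (b * c) = b * bracket a c + bracket a b * c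

namespace PoissonStructure

/-- An isomorphism of `k`-algebras is an isomorphism of Poisson algebras when it intertwines the
two Poisson brackets. -/
def IsPoissonIso {k A B : Type*} [CommRing k] [Ring A] [Algebra k A] [Ring B] [Algebra k B]
    (α : PoissonStructure k A) (β : PoissonStructure k B) (e : A ≃ₐ[k] B) : Prop :=
  ∀ a b, e (α.bracket a b) = β.bracket (e a) (e b)

/-- The group of Poisson automorphisms of a Poisson algebra. -/
def poissonAut {k A : Type*} [CommRing k] [Ring A] [Algebra k A] (π : PoissonStructure k A) :
    Subgroup (A ≃ₐ[k] A) where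
  carrier := {φ | π.IsPoissonIso π φ}
  one_mem' := fun _ _ => rfl
  mul_mem' := by
    intro φ ψ hφ hψ a b
    change φ (ψ _) = π.bracket (φ (ψ a)) (φ (ψ b))
    rw [hψ, hφ]
  inv_mem' := by
    intro φ hφ a b
    change φ.symm _ = π.bracket (φ.symm a) (φ.symm b)
    rw [AlgEquiv.symm_apply_eq, hφ, AlgEquiv.apply_symm_apply, AlgEquiv.apply_symm_apply]

end PoissonStructure

/-- The subalgebra of elements fixed by a group `G` of algebra automorphisms. -/
def invariantSubalgebra {R A : Type*} [CommRing R] [Ring A] [Algebra R A]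
    (G : Subgroup (A ≃ₐ[R] A)) : Subalgebra R A where
  carrier := {a | ∀ φ ∈ G, φ a = a}
  mul_mem' := by
    intro a b ha hb φ hφ
    rw [map_mul, ha φ hφ, hb φ hφ]
  add_mem' := by
    intro a b ha hb φ hφ
    rw [map_add, ha φ hφ, hb φ hφ]
  algebraMap_mem' := fun r φ _ => φ.commutes r

/-- The Poisson structure on the invariants of a group of Poisson automorphisms, obtained by
restricting the bracket. -/
def PoissonStructure.invariants {k A : Type*} [CommRing k] [Ring A] [Algebra k A]
    (π : PoissonStructure k A) (G : Subgroup (A ≃ₐ[k] A)) (hG : G ≤ π.poissonAut) :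
    PoissonStructure k (invariantSubalgebra G) where
  bracket := LinearMap.mk₂ k
    (fun a b => ⟨π.bracket a b, fun φ hφ => by
      rw [hG hφ a b, a.2 φ hφ, b.2 φ hφ]⟩)
    (fun a b c => Subtype.ext (by simp))
    (fun r a b => Subtype.ext (by simp))
    (fun a b c => Subtype.ext (by simp))
    (fun r a b => Subtype.ext (by simp))
  mul_comm' := fun a b => Subtype.ext (π.mul_comm' a b)
  bracket_self := fun a => Subtype.ext (π.bracket_self a)
  jacobi := fun a b c => Subtype.ext (π.jacobi a b c)
  leibniz := fun a b c => Subtype.ext (π.leibniz a b c)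

/-! ### Quadratic Poisson structures on the polynomial algebra in three variables -/

section Poly

variable {k : Type*} [Field k]

/-- The Poisson bracket of two linear forms is a quadratic form. -/
def IsQuadratic (π : PoissonStructure k (MvPolynomial (Fin 3) k)) : Prop :=
  ∀ p q : MvPolynomial (Fin 3) k, p.IsHomogeneous 1 → q.IsHomogeneous 1 →
    (π.bracket p q).IsHomogeneous 2

/-- The Poisson bracket is given by the partial derivatives of a homogeneous polynomial `Ω`
(the variables `x₁, x₂, x₃` are indexed by `0, 1, 2`). -/
def IsUnimodular (π : PoissonStructure k (MvPolynomial (Fin 3) k)) : Prop :=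
  ∃ (Ω : MvPolynomial (Fin 3) k) (n : ℕ), Ω.IsHomogeneous n ∧
    π.bracket (MvPolynomial.X 0) (MvPolynomial.X 1) = MvPolynomial.pderiv 2 Ω ∧
    π.bracket (MvPolynomial.X 1) (MvPolynomial.X 2) = MvPolynomial.pderiv 0 Ω ∧
    π.bracket (MvPolynomial.X 2) (MvPolynomial.X 0) = MvPolynomial.pderiv 1 Ω

/-- The array `c` writes the brackets of the variables as
`{xᵢ, xⱼ} = ∑ₖₗ c i j k l • xₖ xₗ`. -/
def HasCoeffs (π : PoissonStructure k (MvPolynomial (Fin 3) k))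
    (c : Fin 3 → Fin 3 → Fin 3 → Fin 3 → k) : Prop :=
  ∀ i j, π.bracket (MvPolynomial.X i) (MvPolynomial.X j) =
    ∑ p, ∑ q, c i j p q • (MvPolynomial.X p * MvPolynomial.X q)

/-- The group of graded Poisson automorphisms of `k[x₁, x₂, x₃]` for the standard grading. -/
def gradedPoissonAut (π : PoissonStructure k (MvPolynomial (Fin 3) k)) :
    Subgroup (MvPolynomial (Fin 3) k ≃ₐ[k] MvPolynomial (Fin 3) k) where
  carrier := {φ | φ ∈ π.poissonAut ∧
    ∀ (n : ℕ) (p : MvPolynomial (Fin 3) k), (φ p).IsHomogeneous n ↔ p.IsHomogeneous n}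
  one_mem' := ⟨one_mem _, fun _ _ => Iff.rfl⟩
  mul_mem' := by
    rintro φ ψ ⟨hφ, hφ'⟩ ⟨hψ, hψ'⟩
    exact ⟨mul_mem hφ hψ, fun n p => (hφ' n (ψ p)).trans (hψ' n p)⟩
  inv_mem' := by
    rintro φ ⟨hφ, hφ'⟩
    refine ⟨inv_mem hφ, fun n p => ?_⟩
    change (φ.symm p).IsHomogeneous n ↔ _
    rw [← hφ', AlgEquiv.apply_symm_apply]

lemma gradedPoissonAut_le (π : PoissonStructure k (MvPolynomial (Fin 3) k)) :
    gradedPoissonAut π ≤ π.poissonAut := fun _ h => h.1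

/-- The matrix `a` of a graded automorphism `φ`, so that `φ xᵢ = ∑ⱼ a i j • xⱼ`. -/
def linMatrix (φ : MvPolynomial (Fin 3) k ≃ₐ[k] MvPolynomial (Fin 3) k) :
    Matrix (Fin 3) (Fin 3) k :=
  fun i j => MvPolynomial.coeff (Finsupp.single j 1) (φ (MvPolynomial.X i))

/-! ### The standard deformation quantization, with a formal parameter -/

/-- The defining relations
`yᵢ yⱼ - yⱼ yᵢ = (ħ / 2) ∑ₖₗ c i j k l (yₖ yₗ + yₗ yₖ)`
in the free algebra over the ring `k[[ħ]]`; the formal parameter `ħ` is `PowerSeries.X`. -/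
inductive QuantRel (c : Fin 3 → Fin 3 → Fin 3 → Fin 3 → k) :
    FreeAlgebra k⟦X⟧ (Fin 3) → FreeAlgebra k⟦X⟧ (Fin 3) → Prop
  | mk (i j : Fin 3) : QuantRel c
      (FreeAlgebra.ι k⟦X⟧ i * FreeAlgebra.ι k⟦X⟧ j - FreeAlgebra.ι k⟦X⟧ j * FreeAlgebra.ι k⟦X⟧ i)
      (((2 : k)⁻¹ • (PowerSeries.X : k⟦X⟧)) • ∑ p, ∑ q, c i j p q •
        (FreeAlgebra.ι k⟦X⟧ p * FreeAlgebra.ι k⟦X⟧ q +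
          FreeAlgebra.ι k⟦X⟧ q * FreeAlgebra.ι k⟦X⟧ p))

/-- The standard deformation quantization
`P_ħ = k[[ħ]]⟨y₁, y₂, y₃⟩ / ([yᵢ, yⱼ] = (ħ / 2) ∑ₖₗ c i j k l (yₖ yₗ + yₗ yₖ))`. -/
def Quantization (c : Fin 3 → Fin 3 → Fin 3 → Fin 3 → k) : Type _ :=
  RingQuot (QuantRel c)

namespace Quantization

instance (c : Fin 3 → Fin 3 → Fin 3 → Fin 3 → k) : Ring (Quantization c) :=
  inferInstanceAs (Ring (RingQuot (QuantRel c)))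

instance (c : Fin 3 → Fin 3 → Fin 3 → Fin 3 → k) : Algebra k⟦X⟧ (Quantization c) :=
  inferInstanceAs (Algebra k⟦X⟧ (RingQuot (QuantRel c)))

/-- The `k`-algebra structure, through the constants `k → k[[ħ]]`. -/
instance (c : Fin 3 → Fin 3 → Fin 3 → Fin 3 → k) : Algebra k (Quantization c) :=
  inferInstanceAs (Algebra k (RingQuot (QuantRel c)))

instance (c : Fin 3 → Fin 3 → Fin 3 → Fin 3 → k) : IsScalarTower k k⟦X⟧ (Quantization c) :=
  inferInstanceAs (IsScalarTower k k⟦X⟧ (RingQuot (QuantRel c)))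

/-- The quotient map from the free algebra onto `P_ħ`. -/
def mk (c : Fin 3 → Fin 3 → Fin 3 → Fin 3 → k) :
    FreeAlgebra k⟦X⟧ (Fin 3) →ₐ[k⟦X⟧] Quantization c :=
  RingQuot.mkAlgHom k⟦X⟧ (QuantRel c)

/-- The generators `yᵢ` of `P_ħ`. -/
def y (c : Fin 3 → Fin 3 → Fin 3 → Fin 3 → k) (i : Fin 3) : Quantization c :=
  mk c (FreeAlgebra.ι k⟦X⟧ i)

/-- The universal property of `P_ħ`. -/
def lift (c : Fin 3 → Fin 3 → Fin 3 → Fin 3 → k) {B : Type*} [Ring B] [Algebra k⟦X⟧ B]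
    (f : FreeAlgebra k⟦X⟧ (Fin 3) →ₐ[k⟦X⟧] B)
    (hf : ∀ a b, QuantRel c a b → f a = f b) : Quantization c →ₐ[k⟦X⟧] B :=
  RingQuot.liftAlgHom k⟦X⟧ ⟨f, fun {a b} h => hf a b h⟩

variable {c : Fin 3 → Fin 3 → Fin 3 → Fin 3 → k}

lemma lift_mk {B : Type*} [Ring B] [Algebra k⟦X⟧ B]
    (f : FreeAlgebra k⟦X⟧ (Fin 3) →ₐ[k⟦X⟧] B)
    (hf : ∀ a b, QuantRel c a b → f a = f b) (a : FreeAlgebra k⟦X⟧ (Fin 3)) :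
    lift c f hf (mk c a) = f a :=
  RingQuot.liftAlgHom_mkAlgHom_apply _ _ _ _

lemma hom_ext {B : Type*} [Ring B] [Algebra k⟦X⟧ B] {f g : Quantization c →ₐ[k⟦X⟧] B}
    (h : ∀ i, f (y c i) = g (y c i)) : f = g := by
  apply RingQuot.ringQuot_ext'
  apply FreeAlgebra.hom_ext
  funext i
  exact h i

lemma mk_smul (r : k) (a : FreeAlgebra k⟦X⟧ (Fin 3)) : mk c (r • a) = r • mk c a := by
  rw [← algebraMap_smul k⟦X⟧ r a, ← algebraMap_smul k⟦X⟧ r (mk c a), map_smul]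

lemma y_rel (i j : Fin 3) : y c i * y c j - y c j * y c i =
    ((2 : k)⁻¹ • (PowerSeries.X : k⟦X⟧)) • ∑ p, ∑ q, c i j p q •
      (y c p * y c q + y c q * y c p) := by
  have h : mk c _ = mk c _ := RingQuot.mkAlgHom_rel k⟦X⟧ (QuantRel.mk (c := c) i j)
  simp only [map_sub, map_mul, map_smul, map_sum, mk_smul, map_add] at h
  exact h

/-- The symmetrized product of a quadratic form depends only on the form. -/
lemma sym_eq_sym (d d' : Fin 3 → Fin 3 → k)
    (h : ∑ p, ∑ q, d p q • (MvPolynomial.X p * MvPolynomial.X q : MvPolynomial (Fin 3) k) =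
      ∑ p, ∑ q, d' p q • (MvPolynomial.X p * MvPolynomial.X q)) :
    ∑ p, ∑ q, d p q • (y c p * y c q + y c q * y c p) =
      ∑ p, ∑ q, d' p q • (y c p * y c q + y c q * y c p) := by
  have key : ∀ e : Fin 3 → Fin 3 → k, ∀ p q,
      MvPolynomial.pderiv p (MvPolynomial.pderiv q
        (∑ p, ∑ q, e p q • (MvPolynomial.X p * MvPolynomial.X q : MvPolynomial (Fin 3) k))) =
      MvPolynomial.C (e p q + e q p) := by
    intro e p q
    fin_cases p <;> fin_cases q <;>
      simp [Fin.sum_univ_three, MvPolynomial.pderiv_X, MvPolynomial.smul_eq_C_mul] <;> ring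
  have h2 : ∀ p q, d p q + d q p = d' p q + d' q p := by
    intro p q
    apply MvPolynomial.C_injective (Fin 3) k
    rw [← key, ← key, h]
  have h3 : ∀ e : Fin 3 → Fin 3 → k, ∑ p, ∑ q, e p q • (y c p * y c q + y c q * y c p) =
      ∑ p, ∑ q, (e p q + e q p) • (y c p * y c q) := by
    intro e
    simp only [smul_add, add_smul, Finset.sum_add_distrib]
    congr 1
    exact Finset.sum_comm
  rw [h3, h3]
  simp only [h2]

end Quantization

lemma map_X_eq (π : PoissonStructure k (MvPolynomial (Fin 3) k))
    {φ : MvPolynomial (Fin 3) k ≃ₐ[k] MvPolynomial (Fin 3) k} (hφ : φ ∈ gradedPoissonAut π)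
    (i : Fin 3) : φ (MvPolynomial.X i) = ∑ j, linMatrix φ i j • MvPolynomial.X j := by
  have h1 : (φ (MvPolynomial.X i)).IsHomogeneous 1 :=
    (hφ.2 1 _).2 (MvPolynomial.isHomogeneous_X k i)
  rw [← MvPolynomial.mem_homogeneousSubmodule, MvPolynomial.homogeneousSubmodule_one_eq_span_X,
    Submodule.mem_span_range_iff_exists_fun] at h1
  obtain ⟨b, hb⟩ := h1
  have h2 : ∀ j, linMatrix φ i j = b j := by
    intro j
    rw [linMatrix, ← hb, MvPolynomial.coeff_sum, Finset.sum_eq_single j]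
    · simp
    · intro l _ hl
      rw [MvPolynomial.coeff_smul, MvPolynomial.coeff_X, if_neg, smul_zero]
      intro h
      exact hl (Finsupp.single_left_injective one_ne_zero h)
    · simp
  simp only [h2, hb]

lemma linMatrix_one (i j : Fin 3) :
    linMatrix (1 : MvPolynomial (Fin 3) k ≃ₐ[k] MvPolynomial (Fin 3) k) i j =
      if i = j then 1 else 0 := by
  rw [linMatrix, AlgEquiv.one_apply, MvPolynomial.coeff_X]
  simp [Finsupp.single_left_inj]

lemma linMatrix_mul (π : PoissonStructure k (MvPolynomial (Fin 3) k))
    (φ ψ : gradedPoissonAut π) (i l : Fin 3) :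
    linMatrix (φ * ψ).1 i l = ∑ j, linMatrix ψ.1 i j * linMatrix φ.1 j l := by
  have h : (φ * ψ).1 (MvPolynomial.X i) = φ.1 (ψ.1 (MvPolynomial.X i)) := rfl
  rw [linMatrix, h, map_X_eq π ψ.2, map_sum, MvPolynomial.coeff_sum]
  simp only [map_smul, MvPolynomial.coeff_smul, smul_eq_mul, linMatrix]

lemma sum_comm_four {M : Type*} [AddCommMonoid M]
    (f : Fin 3 → Fin 3 → Fin 3 → Fin 3 → M) :
    ∑ p, ∑ q, ∑ m, ∑ n, f p q m n = ∑ m, ∑ n, ∑ p, ∑ q, f p q m n := by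
  have h1 : ∀ p, ∑ q, ∑ m, ∑ n, f p q m n = ∑ m, ∑ n, ∑ q, f p q m n := by
    intro p
    rw [Finset.sum_comm]
    exact Finset.sum_congr rfl fun m _ => Finset.sum_comm
  simp only [h1]
  rw [Finset.sum_comm]
  exact Finset.sum_congr rfl fun m _ => Finset.sum_comm

/-- The linear substitution given by a graded Poisson automorphism respects the relations. -/
lemma subst_rel (π : PoissonStructure k (MvPolynomial (Fin 3) k))
    (c : Fin 3 → Fin 3 → Fin 3 → Fin 3 → k) (hc : HasCoeffs π c) (φ : gradedPoissonAut π)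
    (Y : Fin 3 → Quantization c) (hY : ∀ i, Y i = ∑ j, linMatrix φ.1 i j • Quantization.y c j)
    (i j : Fin 3) : Y i * Y j - Y j * Y i =
      ((2 : k)⁻¹ • (PowerSeries.X : k⟦X⟧)) • ∑ p, ∑ q, c i j p q •
        (Y p * Y q + Y q * Y p) := by
  have hX := fun i => map_X_eq π φ.2 i
  set a := linMatrix φ.1 with ha
  have hpoly := φ.2.1 (MvPolynomial.X i) (MvPolynomial.X j)
  rw [hc i j, hX i, hX j] at hpoly
  have e1 : Y i * Y j - Y j * Y i = ((2 : k)⁻¹ • (PowerSeries.X : k⟦X⟧)) •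
      ∑ m, ∑ n, (∑ p, ∑ q, a i p * a j q * c p q m n) •
        (Quantization.y c m * Quantization.y c n + Quantization.y c n * Quantization.y c m) := by
    have : Y i * Y j - Y j * Y i = ∑ p, ∑ q, (a i p * a j q) •
        (Quantization.y c p * Quantization.y c q - Quantization.y c q * Quantization.y c p) := by
      simp only [hY, Fin.sum_univ_three, smul_mul_assoc, mul_smul_comm, add_mul, mul_add]
      module
    rw [this]
    simp only [Quantization.y_rel]
    simp only [smul_comm (_ : k) (_ : k⟦X⟧), ← Finset.smul_sum]
    congr 1
    simp only [Finset.smul_sum, Finset.sum_smul, smul_smul]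
    exact sum_comm_four _
  have e2 : ∑ p, ∑ q, c i j p q • (Y p * Y q + Y q * Y p) =
      ∑ m, ∑ n, (∑ p, ∑ q, c i j p q * a p m * a q n) •
        (Quantization.y c m * Quantization.y c n + Quantization.y c n * Quantization.y c m) := by
    simp only [Finset.sum_smul]
    rw [← sum_comm_four]
    refine Finset.sum_congr rfl fun p _ => Finset.sum_congr rfl fun q _ => ?_
    simp only [hY, Fin.sum_univ_three, smul_mul_assoc, mul_smul_comm, add_mul, mul_add]
    module
  rw [e1, e2]
  congr 1
  apply Quantization.sym_eq_sym
  have f1 : π.bracket (∑ p, a i p • MvPolynomial.X p) (∑ q, a j q • MvPolynomial.X q) =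
      ∑ m, ∑ n, (∑ p, ∑ q, a i p * a j q * c p q m n) •
        (MvPolynomial.X m * MvPolynomial.X n : MvPolynomial (Fin 3) k) := by
    simp only [Finset.sum_smul]
    rw [← sum_comm_four]
    simp only [map_sum, map_smul, LinearMap.sum_apply, LinearMap.smul_apply, hc _ _,
      Finset.smul_sum, smul_smul]
    rw [Finset.sum_comm]
    refine Finset.sum_congr rfl fun p _ => Finset.sum_congr rfl fun q _ =>
      Finset.sum_congr rfl fun m _ => Finset.sum_congr rfl fun n _ => ?_
    congr 1
    ring
  have f2 : φ.1 (∑ p, ∑ q, c i j p q • (MvPolynomial.X p * MvPolynomial.X q)) =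
      ∑ m, ∑ n, (∑ p, ∑ q, c i j p q * a p m * a q n) •
        (MvPolynomial.X m * MvPolynomial.X n : MvPolynomial (Fin 3) k) := by
    simp only [Finset.sum_smul]
    rw [← sum_comm_four]
    simp only [map_sum, map_smul, map_mul, hX]
    refine Finset.sum_congr rfl fun p _ => Finset.sum_congr rfl fun q _ => ?_
    simp only [Fin.sum_univ_three, smul_mul_assoc, mul_smul_comm, add_mul, mul_add]
    module
  rw [← f1, ← f2]
  exact hpoly.symm

open Quantization in
/-- The endomorphism of `P_ħ` with `yᵢ ↦ ∑ⱼ a i j • yⱼ`, where `a` is the matrix of `φ`. -/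
def quantHom (π : PoissonStructure k (MvPolynomial (Fin 3) k))
    (c : Fin 3 → Fin 3 → Fin 3 → Fin 3 → k) (hc : HasCoeffs π c) (φ : gradedPoissonAut π) :
    Quantization c →ₐ[k⟦X⟧] Quantization c :=
  lift c (FreeAlgebra.lift k⟦X⟧ fun i => ∑ j, linMatrix φ.1 i j • y c j) (by
    rintro _ _ ⟨i, j⟩
    have hsmul : ∀ (F : FreeAlgebra k⟦X⟧ (Fin 3) →ₐ[k⟦X⟧] Quantization c) (r : k)
        (b : FreeAlgebra k⟦X⟧ (Fin 3)), F (r • b) = r • F b :=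
      fun F r b => F.toLinearMap.map_smul_of_tower r b
    simp only [map_sub, map_mul, map_smul, map_sum, map_add, hsmul, FreeAlgebra.lift_ι_apply]
    exact subst_rel π c hc φ _ (fun _ => rfl) i j)

lemma quantHom_y (π : PoissonStructure k (MvPolynomial (Fin 3) k))
    (c : Fin 3 → Fin 3 → Fin 3 → Fin 3 → k) (hc : HasCoeffs π c) (φ : gradedPoissonAut π)
    (i : Fin 3) : quantHom π c hc φ (Quantization.y c i) =
      ∑ j, linMatrix φ.1 i j • Quantization.y c j := by
  rw [quantHom, Quantization.y, Quantization.lift_mk, FreeAlgebra.lift_ι_apply]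

lemma quantHom_one (π : PoissonStructure k (MvPolynomial (Fin 3) k))
    (c : Fin 3 → Fin 3 → Fin 3 → Fin 3 → k) (hc : HasCoeffs π c) :
    quantHom π c hc 1 = AlgHom.id k⟦X⟧ (Quantization c) := by
  apply Quantization.hom_ext
  intro i
  rw [quantHom_y]
  simp [linMatrix_one]

lemma quantHom_mul (π : PoissonStructure k (MvPolynomial (Fin 3) k))
    (c : Fin 3 → Fin 3 → Fin 3 → Fin 3 → k) (hc : HasCoeffs π c) (φ ψ : gradedPoissonAut π) :
    quantHom π c hc (φ * ψ) = (quantHom π c hc φ).comp (quantHom π c hc ψ) := by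
  apply Quantization.hom_ext
  intro i
  have hsmul : ∀ (F : Quantization c →ₐ[k⟦X⟧] Quantization c) (r : k)
      (b : Quantization c), F (r • b) = r • F b :=
    fun F r b => F.toLinearMap.map_smul_of_tower r b
  rw [AlgHom.comp_apply, quantHom_y, quantHom_y, map_sum]
  simp only [hsmul, quantHom_y, linMatrix_mul, Finset.sum_smul, Finset.smul_sum, smul_smul]
  exact Finset.sum_comm

/-- The degree `n` part of `P_ħ`: the `k[[ħ]]`-span of the words of length `n` in the `yᵢ`. -/
def Quantization.degreePart (c : Fin 3 → Fin 3 → Fin 3 → Fin 3 → k) (n : ℕ) :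
    Submodule k⟦X⟧ (Quantization c) :=
  (Submodule.span k⟦X⟧ (Set.range (Quantization.y c))) ^ n

/-- The group of graded `k[[ħ]]`-algebra automorphisms of `P_ħ`. -/
def Quantization.gradedAut (c : Fin 3 → Fin 3 → Fin 3 → Fin 3 → k) :
    Subgroup (Quantization c ≃ₐ[k⟦X⟧] Quantization c) where
  carrier := {ψ | ∀ n, (degreePart c n).map ψ.toLinearMap = degreePart c n}
  one_mem' := fun n => Submodule.map_id _
  mul_mem' := by
    intro φ ψ hφ hψ n
    have : (φ * ψ).toLinearMap = φ.toLinearMap.comp ψ.toLinearMap := rfl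
    rw [this, Submodule.map_comp, hψ, hφ]
  inv_mem' := by
    intro φ hφ n
    have : (φ⁻¹).toLinearMap.comp φ.toLinearMap = LinearMap.id := by
      ext a
      exact φ.symm_apply_apply a
    conv_lhs => rw [← hφ n]
    rw [← Submodule.map_comp, this, Submodule.map_id]

lemma quantHom_map_le (π : PoissonStructure k (MvPolynomial (Fin 3) k))
    (c : Fin 3 → Fin 3 → Fin 3 → Fin 3 → k) (hc : HasCoeffs π c) (φ : gradedPoissonAut π) (n : ℕ) :
    (Quantization.degreePart c n).map (quantHom π c hc φ).toLinearMap ≤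
      Quantization.degreePart c n := by
  rw [Quantization.degreePart, Submodule.map_pow]
  refine pow_le_pow_left' ?_ n
  rw [Submodule.map_span_le]
  rintro _ ⟨i, rfl⟩
  rw [AlgHom.toLinearMap_apply, quantHom_y]
  refine Submodule.sum_mem _ fun j _ => ?_
  rw [← algebraMap_smul k⟦X⟧]
  exact Submodule.smul_mem _ _ (Submodule.subset_span ⟨j, rfl⟩)

/-- The automorphism `φ_ħ` of `P_ħ` corresponding to a graded Poisson automorphism `φ`. -/
def quantEquiv (π : PoissonStructure k (MvPolynomial (Fin 3) k))
    (c : Fin 3 → Fin 3 → Fin 3 → Fin 3 → k) (hc : HasCoeffs π c) (φ : gradedPoissonAut π) :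
    Quantization c ≃ₐ[k⟦X⟧] Quantization c :=
  AlgEquiv.ofAlgHom (quantHom π c hc φ) (quantHom π c hc φ⁻¹)
    (by rw [← quantHom_mul, mul_inv_cancel, quantHom_one])
    (by rw [← quantHom_mul, inv_mul_cancel, quantHom_one])

/-- The homomorphism `φ ↦ φ_ħ` from the graded Poisson automorphisms of `P` to the graded
automorphisms of `P_ħ`: if `φ xᵢ = ∑ⱼ a i j • xⱼ` then `φ_ħ yᵢ = ∑ⱼ a i j • yⱼ`. -/
def quantAut (π : PoissonStructure k (MvPolynomial (Fin 3) k))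
    (c : Fin 3 → Fin 3 → Fin 3 → Fin 3 → k) (hc : HasCoeffs π c) :
    gradedPoissonAut π →* Quantization.gradedAut c where
  toFun φ := ⟨quantEquiv π c hc φ, fun n => le_antisymm (quantHom_map_le π c hc φ n) (by
    intro x hx
    refine ⟨quantHom π c hc φ⁻¹ x, quantHom_map_le π c hc φ⁻¹ n ⟨x, hx, rfl⟩, ?_⟩
    exact (quantEquiv π c hc φ).apply_symm_apply x)⟩
  map_one' := by
    apply Subtype.ext
    apply AlgEquiv.ext
    intro x
    exact DFunLike.congr_fun (quantHom_one π c hc) x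
  map_mul' φ ψ := by
    apply Subtype.ext
    apply AlgEquiv.ext
    intro x
    exact DFunLike.congr_fun (quantHom_mul π c hc φ ψ) x

/-- The group `G_ħ` of graded automorphisms of `P_ħ` corresponding to a group `G` of graded
Poisson automorphisms of `P`. -/
def quantGroup (π : PoissonStructure k (MvPolynomial (Fin 3) k))
    (c : Fin 3 → Fin 3 → Fin 3 → Fin 3 → k) (hc : HasCoeffs π c)
    (G : Subgroup (gradedPoissonAut π)) : Subgroup (Quantization.gradedAut c) :=
  G.map (quantAut π c hc)

/-- The invariant subalgebra `Pᴳ`. -/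
abbrev classicalInvariants (π : PoissonStructure k (MvPolynomial (Fin 3) k))
    (G : Subgroup (gradedPoissonAut π)) : Subalgebra k (MvPolynomial (Fin 3) k) :=
  invariantSubalgebra (G.map (gradedPoissonAut π).subtype)

/-- The Poisson structure of `Pᴳ`, restricted from `P`. -/
def classicalInvariantsPoisson (π : PoissonStructure k (MvPolynomial (Fin 3) k))
    (G : Subgroup (gradedPoissonAut π)) : PoissonStructure k (classicalInvariants π G) :=
  π.invariants _ (by
    rintro _ ⟨φ, _, rfl⟩
    exact φ.2.1)

/-- The invariant subalgebra `Q_ħ` of `P_ħ` under `G_ħ`, an algebra over `k[[ħ]]`. -/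
abbrev quantInvariants (π : PoissonStructure k (MvPolynomial (Fin 3) k))
    (c : Fin 3 → Fin 3 → Fin 3 → Fin 3 → k) (hc : HasCoeffs π c)
    (G : Subgroup (gradedPoissonAut π)) : Subalgebra k⟦X⟧ (Quantization c) :=
  invariantSubalgebra ((quantGroup π c hc G).map (Quantization.gradedAut c).subtype)

/-! ### Reduction modulo `ħ` -/

/-- The two-sided ideal `(ħ)` of a `k[[ħ]]`-algebra. -/
def hIdeal (k A : Type*) [Field k] [Ring A] [Algebra k⟦X⟧ A] : Ideal A :=
  Ideal.span {algebraMap k⟦X⟧ A PowerSeries.X}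

instance (k A : Type*) [Field k] [Ring A] [Algebra k⟦X⟧ A] : (hIdeal k A).IsTwoSided where
  mul_mem_of_left := by
    intro a b ha
    obtain ⟨d, rfl⟩ := Ideal.mem_span_singleton'.1 ha
    rw [mul_assoc, Algebra.commutes, ← mul_assoc]
    exact Ideal.mul_mem_left _ _ (Ideal.subset_span rfl)

/-- The bracket of a Poisson structure `β` on `A/(ħ)` is the one induced by commutators: whenever
`f g - g f = ħ p` in `A`, the bracket of the classes of `f` and `g` is the class of `p`. -/
def IsSemiclassicalLimit {k A : Type*} [Field k] [Ring A] [Algebra k⟦X⟧ A] [Algebra k A]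
    (β : PoissonStructure k (A ⧸ hIdeal k A)) : Prop :=
  ∀ f g p : A, f * g - g * f = (PowerSeries.X : k⟦X⟧) • p →
    β.bracket (Ideal.Quotient.mk _ f) (Ideal.Quotient.mk _ g) = Ideal.Quotient.mk _ p

end Poly
end

/-! The proof sees `P_ħ` only to first order in `ħ`, so neither a PBW basis nor torsion-freeness
over `k[[ħ]]` is required. On `A ⊕ ħA` the product `ab + (ħ/2){a, b}` is associative by the Leibniz
rule alone, and the commutator there has `ħ`-coefficient `{a, b}`. The defining relations hold in
this ring, which gives `toFirstOrder`, and its constant term is a surjection `reduction` from `P_ħ`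
to `P`. Comparing `ħ`-coefficients shows that `fg - gf = ħp` forces the bracket of the reductions to
be the reduction of `p`, whichever `p` was chosen (`bracket_reduction`).

The kernel of `reduction` is exactly `(ħ)`: the generators commute modulo `ħ`, so `P_ħ/(ħ)` is
commutative and receives a map back from the polynomial ring (`mem_hIdeal_of_reduction_eq_zero`).

Averaging over the finite group, possible in characteristic 0, carries all this to invariants: it
lifts invariant polynomials to invariant elements and allows division by `ħ` inside `Q_ħ`
(`exists_eq_X_smul`). Hence `Q_ħ/(ħ) ≃ Pᴳ`, and the bracket on the quotient is the one transported
from `Pᴳ`. -/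

noncomputable section

/-! ### Formal consequences of the Poisson axioms, and transport of structure. -/

namespace PoissonStructure

variable {k A : Type*} [Field k] [Ring A] [Algebra k A] (π : PoissonStructure k A)

lemma bracket_skew (a b : A) : π.bracket a b = -π.bracket b a := by
  have h := π.bracket_self (a + b)
  simp only [map_add, LinearMap.add_apply, π.bracket_self, zero_add, add_zero] at h
  exact eq_neg_of_add_eq_zero_right h

lemma bracket_one_right (a : A) : π.bracket a 1 = 0 := by
  have h := π.leibniz a 1 1
  simpa using h

lemma bracket_algebraMap_right (a : A) (r : k) : π.bracket a (algebraMap k A r) = 0 := by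
  rw [Algebra.algebraMap_eq_smul_one, map_smul, bracket_one_right, smul_zero]

lemma bracket_algebraMap_left (r : k) (a : A) : π.bracket (algebraMap k A r) a = 0 := by
  rw [bracket_skew, bracket_algebraMap_right, neg_zero]

lemma leibniz_left (a b c : A) :
    π.bracket (a * b) c = a * π.bracket b c + π.bracket a c * b := by
  rw [bracket_skew, π.leibniz, neg_add, ← mul_neg, ← neg_mul, ← bracket_skew, ← bracket_skew]

/-- Transport of a Poisson structure along an isomorphism of algebras. -/
def comap {B : Type*} [Ring B] [Algebra k B] (e : B ≃ₐ[k] A) : PoissonStructure k B where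
  bracket := LinearMap.mk₂ k (fun a b => e.symm (π.bracket (e a) (e b)))
    (fun a b c => by simp) (fun r a b => by simp) (fun a b c => by simp) (fun r a b => by simp)
  mul_comm' a b := e.injective (by rw [map_mul, map_mul, π.mul_comm'])
  bracket_self a := by simp [π.bracket_self]
  jacobi a b c := e.injective (by simpa using π.jacobi (e a) (e b) (e c))
  leibniz a b c := e.injective (by simpa using π.leibniz (e a) (e b) (e c))

lemma comap_bracket {B : Type*} [Ring B] [Algebra k B] (e : B ≃ₐ[k] A) (a b : B) :
    e ((π.comap e).bracket a b) = π.bracket (e a) (e b) :=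
  e.apply_symm_apply _

/-! ### The first-order quantization `A ⊕ ħA`. -/

/-- The quantization of a Poisson algebra modulo `ħ ^ 2`: the elements are `a + ħ b`, and the
product is determined by `a * b = ab + (ħ / 2) {a, b}`. -/
@[ext]
structure FirstOrder {k A : Type*} [Field k] [Ring A] [Algebra k A]
    (π : PoissonStructure k A) where
  /-- the constant term -/
  fst : A
  /-- the coefficient of `ħ` -/
  snd : A

namespace FirstOrder

variable {π}

instance : Zero π.FirstOrder := ⟨⟨0, 0⟩⟩
instance : One π.FirstOrder := ⟨⟨1, 0⟩⟩
instance : Add π.FirstOrder := ⟨fun a b => ⟨a.fst + b.fst, a.snd + b.snd⟩⟩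
instance : Neg π.FirstOrder := ⟨fun a => ⟨-a.fst, -a.snd⟩⟩
instance : Mul π.FirstOrder := ⟨fun a b => ⟨a.fst * b.fst,
  a.fst * b.snd + a.snd * b.fst + (2 : k)⁻¹ • π.bracket a.fst b.fst⟩⟩

@[simp] lemma fst_zero : (0 : π.FirstOrder).fst = 0 := rfl
@[simp] lemma snd_zero : (0 : π.FirstOrder).snd = 0 := rfl
@[simp] lemma fst_one : (1 : π.FirstOrder).fst = 1 := rfl
@[simp] lemma snd_one : (1 : π.FirstOrder).snd = 0 := rfl
@[simp] lemma fst_add (a b : π.FirstOrder) : (a + b).fst = a.fst + b.fst := rfl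
@[simp] lemma snd_add (a b : π.FirstOrder) : (a + b).snd = a.snd + b.snd := rfl
@[simp] lemma fst_neg (a : π.FirstOrder) : (-a).fst = -a.fst := rfl
@[simp] lemma snd_neg (a : π.FirstOrder) : (-a).snd = -a.snd := rfl
@[simp] lemma fst_mul (a b : π.FirstOrder) : (a * b).fst = a.fst * b.fst := rfl
@[simp] lemma snd_mul (a b : π.FirstOrder) : (a * b).snd =
    a.fst * b.snd + a.snd * b.fst + (2 : k)⁻¹ • π.bracket a.fst b.fst := rfl

instance : Ring π.FirstOrder where
  add_assoc a b c := FirstOrder.ext (add_assoc _ _ _) (add_assoc _ _ _)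
  zero_add a := FirstOrder.ext (zero_add _) (zero_add _)
  add_zero a := FirstOrder.ext (add_zero _) (add_zero _)
  add_comm a b := FirstOrder.ext (add_comm _ _) (add_comm _ _)
  neg_add_cancel a := FirstOrder.ext (neg_add_cancel _) (neg_add_cancel _)
  nsmul := nsmulRec
  zsmul := zsmulRec
  -- By Leibniz in each argument, the bracket terms on both sides are half of `a{b, c} + {a, c}b +
  -- {a, b}c`. Jacobi would enter only at order `ħ ^ 2`.
  mul_assoc a b c := FirstOrder.ext (mul_assoc _ _ _) (by
    simp only [fst_mul, snd_mul, π.leibniz, π.leibniz_left, mul_add, add_mul, smul_add,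
      mul_smul_comm, smul_mul_assoc, mul_assoc, π.mul_comm' (π.bracket a.fst c.fst) b.fst]
    abel)
  one_mul a := FirstOrder.ext (one_mul _)
    (by simp [π.bracket_skew 1, π.bracket_one_right])
  mul_one a := FirstOrder.ext (mul_one _) (by simp [π.bracket_one_right])
  left_distrib a b c := FirstOrder.ext (mul_add _ _ _) (by simp [mul_add]; abel)
  right_distrib a b c := FirstOrder.ext (add_mul _ _ _) (by simp [add_mul]; abel)
  zero_mul a := FirstOrder.ext (zero_mul _) (by simp)
  mul_zero a := FirstOrder.ext (mul_zero _) (by simp)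

@[simp] lemma fst_sub (a b : π.FirstOrder) : (a - b).fst = a.fst - b.fst := by
  simp [sub_eq_add_neg]
@[simp] lemma snd_sub (a b : π.FirstOrder) : (a - b).snd = a.snd - b.snd := by
  simp [sub_eq_add_neg]

variable (π) in
/-- The structure map `k[[ħ]] → A ⊕ ħ A`. -/
def scalarHom : k⟦X⟧ →+* π.FirstOrder where
  toFun r := ⟨algebraMap k A (PowerSeries.coeff 0 r), algebraMap k A (PowerSeries.coeff 1 r)⟩
  map_one' := FirstOrder.ext (by simp) (by simp [PowerSeries.coeff_one])
  map_zero' := FirstOrder.ext (by simp) (by simp)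
  map_add' r s := FirstOrder.ext (by simp) (by simp)
  map_mul' r s := FirstOrder.ext (by simp) (by
    simp [PowerSeries.coeff_mul, Finset.Nat.antidiagonal_succ, bracket_algebraMap_right])

/-- Scalars are central because the bracket vanishes on constants, so the twisted product with a
scalar is the ordinary one. -/
instance : Algebra k⟦X⟧ π.FirstOrder :=
  (scalarHom π).toAlgebra' fun r a => FirstOrder.ext (Algebra.commutes _ _) (by
    simp [scalarHom, bracket_algebraMap_right, bracket_algebraMap_left, Algebra.commutes]
    rw [add_comm])

@[simp] lemma fst_algebraMap (r : k⟦X⟧) : (algebraMap k⟦X⟧ π.FirstOrder r).fst =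
    algebraMap k A (PowerSeries.constantCoeff r) := by
  rw [← PowerSeries.coeff_zero_eq_constantCoeff]; rfl

@[simp] lemma snd_algebraMap (r : k⟦X⟧) : (algebraMap k⟦X⟧ π.FirstOrder r).snd =
    algebraMap k A (PowerSeries.coeff 1 r) := rfl

lemma fst_smul (r : k⟦X⟧) (a : π.FirstOrder) : (r • a).fst =
    PowerSeries.constantCoeff r • a.fst := by
  rw [Algebra.smul_def, fst_mul, fst_algebraMap, Algebra.smul_def]

lemma snd_smul (r : k⟦X⟧) (a : π.FirstOrder) : (r • a).snd =
    PowerSeries.constantCoeff r • a.snd + PowerSeries.coeff 1 r • a.fst := by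
  rw [Algebra.smul_def, snd_mul, fst_algebraMap, snd_algebraMap, bracket_algebraMap_left,
    smul_zero, add_zero, Algebra.smul_def, Algebra.smul_def]

/-- The constant term, as a ring homomorphism. -/
def fstHom : π.FirstOrder →+* A where
  toFun := fst
  map_one' := rfl
  map_zero' := rfl
  map_add' _ _ := rfl
  map_mul' _ _ := rfl

/-- The terms linear in the `ħ`-parts cancel by commutativity of `A`; by skew-symmetry the two
halves of the bracket add up to the whole. -/
lemma snd_commutator [NeZero (2 : k)] (a b : π.FirstOrder) :
    (a * b - b * a).snd = π.bracket a.fst b.fst := by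
  have h : (2 : k)⁻¹ • π.bracket a.fst b.fst + (2 : k)⁻¹ • π.bracket a.fst b.fst =
      π.bracket a.fst b.fst := by
    rw [← two_smul k, smul_smul, mul_inv_cancel₀ two_ne_zero, one_smul]
  rw [snd_sub, snd_mul, snd_mul, π.bracket_skew b.fst, π.mul_comm' a.fst b.snd,
    π.mul_comm' a.snd]
  nth_rw 3 [← h]
  rw [smul_neg]
  abel

end FirstOrder

end PoissonStructure
end

/-! ### Divisibility by `ħ`, and commutativity of `P_ħ` modulo `ħ`. -/

noncomputable section

section Poly

variable {k : Type*} [Field k]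

lemma PowerSeries.exists_eq_C_add_X_smul (r : k⟦X⟧) :
    ∃ s : k⟦X⟧, r = algebraMap k k⟦X⟧ (constantCoeff r) + X * s := by
  have h : (X : k⟦X⟧) ∣ r - algebraMap k k⟦X⟧ (constantCoeff r) := by
    rw [PowerSeries.X_dvd_iff]
    simp
  obtain ⟨s, hs⟩ := h
  exact ⟨s, by rw [← hs]; ring⟩

section HIdeal

variable {A : Type*} [Ring A] [Algebra k⟦X⟧ A]

/-- Since `ħ` is central, the left ideal it generates is the set of its multiples. -/
lemma mem_hIdeal_iff {a : A} : a ∈ hIdeal k A ↔ ∃ b : A, a = (PowerSeries.X : k⟦X⟧) • b := by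
  rw [hIdeal, Ideal.mem_span_singleton']
  refine exists_congr fun b => ?_
  rw [Algebra.smul_def, Algebra.commutes]
  exact eq_comm

lemma X_smul_mem_hIdeal (a : A) : (PowerSeries.X : k⟦X⟧) • a ∈ hIdeal k A :=
  mem_hIdeal_iff.2 ⟨a, rfl⟩

end HIdeal

namespace Quantization

variable {c : Fin 3 → Fin 3 → Fin 3 → Fin 3 → k}

lemma induction_on {p : Quantization c → Prop} (a : Quantization c)
    (h_algebraMap : ∀ r, p (algebraMap k⟦X⟧ _ r)) (h_y : ∀ i, p (y c i))
    (h_add : ∀ a b, p a → p b → p (a + b)) (h_mul : ∀ a b, p a → p b → p (a * b)) : p a := by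
  obtain ⟨w, rfl⟩ : ∃ w, mk c w = a := RingQuot.mkAlgHom_surjective k⟦X⟧ (QuantRel c) a
  induction w using FreeAlgebra.induction with
  | grade0 r => rw [AlgHom.commutes]; exact h_algebraMap r
  | grade1 i => exact h_y i
  | mul a b ha hb => rw [map_mul]; exact h_mul _ _ ha hb
  | add a b ha hb => rw [map_add]; exact h_add _ _ ha hb

/-- Commuting is stable under sums and products and automatic for scalars, so a double induction
reduces to two generators, whose commutator is a multiple of `ħ` by `y_rel`. -/
lemma commute_mk (a b : Quantization c) :
    Commute (Ideal.Quotient.mk (hIdeal k (Quantization c)) a)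
      (Ideal.Quotient.mk (hIdeal k (Quantization c)) b) := by
  have h_scalar : ∀ (r : k⟦X⟧) (a : Quantization c),
      Commute (Ideal.Quotient.mk (hIdeal k (Quantization c)) (algebraMap _ _ r))
        (Ideal.Quotient.mk (hIdeal k (Quantization c)) a) := fun r a => by
    rw [commute_iff_eq, ← map_mul, ← map_mul, Algebra.commutes]
  induction a using induction_on with
  | h_algebraMap r => exact h_scalar r b
  | h_add a a' ha ha' => rw [map_add]; exact ha.add_left ha'
  | h_mul a a' ha ha' => rw [map_mul]; exact ha.mul_left ha'
  | h_y i =>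
    induction b using induction_on with
    | h_algebraMap r => exact (h_scalar r _).symm
    | h_add a a' ha ha' => rw [map_add]; exact ha.add_right ha'
    | h_mul a a' ha ha' => rw [map_mul]; exact ha.mul_right ha'
    | h_y j =>
      rw [commute_iff_eq, ← map_mul, ← map_mul, Ideal.Quotient.eq, y_rel, smul_assoc, smul_comm]
      exact X_smul_mem_hIdeal _

lemma exists_commutator_eq (a b : Quantization c) :
    ∃ p : Quantization c, a * b - b * a = (PowerSeries.X : k⟦X⟧) • p := by
  rw [← mem_hIdeal_iff, ← Ideal.Quotient.eq, map_mul, map_mul]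
  exact commute_mk a b

lemma algebraMap_eq (r : k) : algebraMap k (Quantization c) r =
    algebraMap k⟦X⟧ _ (algebraMap k k⟦X⟧ r) :=
  IsScalarTower.algebraMap_apply k k⟦X⟧ _ r

/-! ### Reduction of `P_ħ` modulo `ħ ^ 2` and modulo `ħ`. -/

section FirstOrder

variable [NeZero (2 : k)] (π : PoissonStructure k (MvPolynomial (Fin 3) k)) (hc : HasCoeffs π c)

/-- The reduction of the standard deformation quantization modulo `ħ ^ 2`. -/
def toFirstOrder : Quantization c →ₐ[k⟦X⟧] π.FirstOrder :=
  lift c (FreeAlgebra.lift k⟦X⟧ fun i => ⟨MvPolynomial.X i, 0⟩) (by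
    rintro _ _ ⟨i, j⟩
    set F := FreeAlgebra.lift k⟦X⟧
      fun i => (⟨MvPolynomial.X i, 0⟩ : π.FirstOrder) with hF
    have hι : ∀ i, F (FreeAlgebra.ι _ i) = ⟨MvPolynomial.X i, 0⟩ :=
      fun i => FreeAlgebra.lift_ι_apply _ _
    have hsmul : ∀ (r : k) b, (F (r • b)).fst = r • (F b).fst := fun r b => by
      rw [← algebraMap_smul k⟦X⟧ r b, map_smul, PoissonStructure.FirstOrder.fst_smul]
      simp
    have hsum : ∀ f : Fin 3 → FreeAlgebra k⟦X⟧ (Fin 3),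
        (F (∑ p, f p)).fst = ∑ p, (F (f p)).fst := fun f => by
      simp [Fin.sum_univ_three]
    apply PoissonStructure.FirstOrder.ext
    -- Constant terms: the commutator vanishes in a commutative ring, and the other side carries a
    -- factor `ħ`.
    · rw [smul_assoc, smul_comm, map_smul, PoissonStructure.FirstOrder.fst_smul]
      simp [hι, mul_comm]
    -- Coefficients of `ħ`: symmetrization doubles each monomial, which cancels the `1/2` and leaves
    -- `{xᵢ, xⱼ}`.
    · rw [map_sub, map_mul, map_mul, PoissonStructure.FirstOrder.snd_commutator, hι, hι, hc,
        map_smul, PoissonStructure.FirstOrder.snd_smul]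
      simp only [hsum, hsmul, map_add, map_mul, PoissonStructure.FirstOrder.fst_add,
        PoissonStructure.FirstOrder.fst_mul, hι, mul_comm (MvPolynomial.X _) (MvPolynomial.X _)]
      simp only [← two_smul k (_ * _ : MvPolynomial (Fin 3) k), smul_comm _ (2 : k),
        ← Finset.smul_sum]
      simp [smul_inv_smul₀ (two_ne_zero (α := k))])

lemma toFirstOrder_y (i : Fin 3) : toFirstOrder π hc (y c i) = ⟨MvPolynomial.X i, 0⟩ := by
  rw [toFirstOrder, y, lift_mk, FreeAlgebra.lift_ι_apply]

/-- The reduction modulo `ħ` of the standard deformation quantization. -/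
def reduction : Quantization c →+* MvPolynomial (Fin 3) k :=
  PoissonStructure.FirstOrder.fstHom.comp (toFirstOrder π hc : Quantization c →+* π.FirstOrder)

lemma reduction_apply (a : Quantization c) : reduction π hc a = (toFirstOrder π hc a).fst := rfl

@[simp] lemma reduction_y (i : Fin 3) : reduction π hc (y c i) = MvPolynomial.X i := by
  rw [reduction_apply, toFirstOrder_y]

@[simp] lemma reduction_algebraMap (r : k⟦X⟧) : reduction π hc (algebraMap _ _ r) =
    MvPolynomial.C (PowerSeries.constantCoeff r) := by
  rw [reduction_apply, AlgHom.commutes, PoissonStructure.FirstOrder.fst_algebraMap]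
  rfl

lemma reduction_smul (r : k) (a : Quantization c) :
    reduction π hc (r • a) = r • reduction π hc a := by
  rw [Algebra.smul_def, map_mul, algebraMap_eq, reduction_algebraMap, MvPolynomial.smul_eq_C_mul]
  simp

lemma reduction_X_smul (a : Quantization c) :
    reduction π hc ((PowerSeries.X : k⟦X⟧) • a) = 0 := by
  rw [Algebra.smul_def, map_mul, reduction_algebraMap]
  simp

lemma reduction_surjective : Function.Surjective (reduction π hc) := by
  intro p
  induction p using MvPolynomial.induction_on with
  | C r => exact ⟨algebraMap _ _ (algebraMap k k⟦X⟧ r), by simp⟩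
  | add p q hp hq =>
    obtain ⟨a, rfl⟩ := hp
    obtain ⟨b, rfl⟩ := hq
    exact ⟨a + b, map_add _ _ _⟩
  | mul_X p i hp =>
    obtain ⟨a, rfl⟩ := hp
    exact ⟨a * y c i, by simp⟩

/-- The Poisson bracket is the first order term of the commutator. -/
lemma bracket_reduction {a b p : Quantization c}
    (h : a * b - b * a = (PowerSeries.X : k⟦X⟧) • p) :
    π.bracket (reduction π hc a) (reduction π hc b) = reduction π hc p := by
  have h' := congrArg (fun x => (toFirstOrder π hc x).snd) h
  simp only [map_sub, map_mul, PoissonStructure.FirstOrder.snd_commutator, map_smul,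
    PoissonStructure.FirstOrder.snd_smul] at h'
  simpa [reduction_apply] using h'

/-- The quotient map to `P_ħ/(ħ)` factors through `reduction`, so it kills whatever `reduction`
kills. -/
lemma mem_hIdeal_of_reduction_eq_zero {a : Quantization c} (ha : reduction π hc a = 0) :
    a ∈ hIdeal k (Quantization c) := by
  -- Evaluating polynomials at the classes of the `yᵢ` requires a commutative target.
  let : CommRing (Quantization c ⧸ hIdeal k (Quantization c)) :=
    { (inferInstance : Ring (Quantization c ⧸ hIdeal k (Quantization c))) with
      mul_comm := by
        intro a b
        obtain ⟨a, rfl⟩ := Ideal.Quotient.mk_surjective a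
        obtain ⟨b, rfl⟩ := Ideal.Quotient.mk_surjective b
        exact commute_mk a b }
  let s : MvPolynomial (Fin 3) k →+* Quantization c ⧸ hIdeal k (Quantization c) :=
    MvPolynomial.eval₂Hom
      ((Ideal.Quotient.mk (hIdeal k (Quantization c))).comp (algebraMap k (Quantization c)))
      fun i => Ideal.Quotient.mk _ (y c i)
  -- Both sides are ring homomorphisms in `b`, so it suffices to compare generators and scalars; a
  -- power series agrees with its constant term modulo `ħ`.
  have hs : ∀ b, s (reduction π hc b) = Ideal.Quotient.mk _ b := by
    intro b
    induction b using induction_on with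
    | h_algebraMap r =>
      obtain ⟨t, ht⟩ := PowerSeries.exists_eq_C_add_X_smul r
      rw [reduction_algebraMap, MvPolynomial.coe_eval₂Hom, MvPolynomial.eval₂_C,
        RingHom.comp_apply, algebraMap_eq, eq_comm, Ideal.Quotient.eq, ← map_sub]
      have : r - algebraMap k k⟦X⟧ (PowerSeries.constantCoeff r) =
          (PowerSeries.X : k⟦X⟧) • t := by
        rw [smul_eq_mul]
        linear_combination ht
      rw [this, Algebra.algebraMap_eq_smul_one, smul_assoc]
      exact X_smul_mem_hIdeal _
    | h_y i => rw [reduction_y, MvPolynomial.coe_eval₂Hom, MvPolynomial.eval₂_X]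
    | h_add a b ha hb => rw [map_add, map_add, map_add, ha, hb]
    | h_mul a b ha hb => rw [map_mul, map_mul, map_mul, ha, hb]
  rw [← Ideal.Quotient.eq_zero_iff_mem, ← hs, ha, map_zero]

lemma reduction_quantHom (φ : gradedPoissonAut π) (a : Quantization c) :
    reduction π hc (quantHom π c hc φ a) = φ.1 (reduction π hc a) := by
  induction a using induction_on with
  | h_algebraMap r =>
    rw [AlgHom.commutes, reduction_algebraMap]
    exact (φ.1.commutes _).symm
  | h_y i =>
    rw [quantHom_y, reduction_y, map_X_eq π φ.2, map_sum]
    simp only [reduction_smul, reduction_y]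
  | h_add a b ha hb => simp only [map_add, ha, hb]
  | h_mul a b ha hb => simp only [map_mul, ha, hb]

end FirstOrder

end Quantization

/-! ### Averaging over `G`, and reduction of the invariants. -/

section Invariants

variable (π : PoissonStructure k (MvPolynomial (Fin 3) k))
  {c : Fin 3 → Fin 3 → Fin 3 → Fin 3 → k} (hc : HasCoeffs π c)
  (G : Subgroup (gradedPoissonAut π))

lemma mem_classicalInvariants {p : MvPolynomial (Fin 3) k} :
    p ∈ classicalInvariants π G ↔ ∀ φ ∈ G, φ.1 p = p := by
  refine ⟨fun h φ hφ => h _ ⟨φ, hφ, rfl⟩, ?_⟩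
  rintro h _ ⟨φ, hφ, rfl⟩
  exact h φ hφ

lemma mem_quantInvariants {a : Quantization c} :
    a ∈ quantInvariants π c hc G ↔ ∀ φ ∈ G, quantHom π c hc φ a = a := by
  refine ⟨fun h φ hφ => h _ ⟨_, ⟨φ, hφ, rfl⟩, rfl⟩, ?_⟩
  rintro h _ ⟨_, ⟨φ, hφ, rfl⟩, rfl⟩
  exact h φ hφ

variable [Finite G]

/-- The average of an element of `P_ħ` over a finite group of graded Poisson automorphisms. -/
def quantAverage (a : Quantization c) : Quantization c :=
  letI := Fintype.ofFinite G
  (Nat.card G : k)⁻¹ • ∑ φ : G, quantHom π c hc φ.1 a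

lemma quantAverage_mem (a : Quantization c) :
    quantAverage π hc G a ∈ quantInvariants π c hc G := by
  let := Fintype.ofFinite G
  rw [mem_quantInvariants]
  intro ψ hψ
  rw [quantAverage, ← AlgHom.toLinearMap_apply, LinearMap.map_smul_of_tower]
  congr 1
  rw [map_sum]
  -- Applying `ψ` permutes the summands by left translation.
  refine Fintype.sum_equiv (Equiv.mulLeft ⟨ψ, hψ⟩) _ _ fun φ => ?_
  rw [AlgHom.toLinearMap_apply, ← AlgHom.comp_apply, ← quantHom_mul]
  rfl

lemma quantAverage_smul (r : k⟦X⟧) (a : Quantization c) :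
    quantAverage π hc G (r • a) = r • quantAverage π hc G a := by
  simp only [quantAverage, map_smul, ← Finset.smul_sum]
  rw [smul_comm]

variable [CharZero k]

lemma quantAverage_of_mem {a : Quantization c} (ha : a ∈ quantInvariants π c hc G) :
    quantAverage π hc G a = a := by
  let := Fintype.ofFinite G
  rw [mem_quantInvariants] at ha
  rw [quantAverage, Finset.sum_congr rfl fun φ _ => ha φ.1 φ.2, Finset.sum_const,
    Finset.card_univ, ← Nat.card_eq_fintype_card, ← Nat.cast_smul_eq_nsmul k, smul_smul,
    inv_mul_cancel₀ (Nat.cast_ne_zero.2 Nat.card_pos.ne'), one_smul]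

lemma reduction_quantAverage {a : Quantization c}
    (ha : Quantization.reduction π hc a ∈ classicalInvariants π G) :
    Quantization.reduction π hc (quantAverage π hc G a) = Quantization.reduction π hc a := by
  let := Fintype.ofFinite G
  rw [mem_classicalInvariants] at ha
  rw [quantAverage, Quantization.reduction_smul, map_sum,
    Finset.sum_congr rfl fun φ _ => (Quantization.reduction_quantHom π hc φ.1 a).trans
      (ha φ.1 φ.2), Finset.sum_const,
    Finset.card_univ, ← Nat.card_eq_fintype_card, ← Nat.cast_smul_eq_nsmul k, smul_smul,
    inv_mul_cancel₀ (Nat.cast_ne_zero.2 Nat.card_pos.ne'), one_smul]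

/-- Division by `ħ` of an invariant element can be carried out in the invariants. -/
lemma exists_eq_X_smul (a : quantInvariants π c hc G)
    (ha : (a : Quantization c) ∈ hIdeal k (Quantization c)) :
    ∃ p : quantInvariants π c hc G, a = (PowerSeries.X : k⟦X⟧) • p := by
  obtain ⟨b, hb⟩ := mem_hIdeal_iff.1 ha
  -- From `a = ħb` alone `b` is not known to be invariant, as `ħ`-torsion has not been excluded. Its
  -- average is invariant, and averaging fixes `a` and commutes with `ħ`.
  refine ⟨⟨quantAverage π hc G b, quantAverage_mem π hc G b⟩, Subtype.ext ?_⟩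
  rw [← quantAverage_of_mem π hc G a.2, hb, quantAverage_smul]
  rfl

/-- The reduction modulo `ħ` on the invariants. -/
def invariantsReduction : quantInvariants π c hc G →ₐ[k] classicalInvariants π G where
  toFun a := ⟨Quantization.reduction π hc a, by
    rw [mem_classicalInvariants]
    intro φ hφ
    rw [← Quantization.reduction_quantHom, (mem_quantInvariants π hc G).1 a.2 φ hφ]⟩
  map_one' := Subtype.ext (map_one _)
  map_zero' := Subtype.ext (map_zero _)
  map_mul' a b := Subtype.ext (map_mul _ _ _)
  map_add' a b := Subtype.ext (map_add _ _ _)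
  commutes' r := Subtype.ext (by
    change Quantization.reduction π hc (algebraMap k⟦X⟧ _ (algebraMap k k⟦X⟧ r)) = _
    rw [Quantization.reduction_algebraMap]
    simp)

/-- Average any lift of an invariant polynomial: since `reduction` is equivariant, the average is
still a lift. -/
lemma invariantsReduction_surjective : Function.Surjective (invariantsReduction π hc G) := by
  rintro ⟨p, hp⟩
  obtain ⟨a, rfl⟩ := Quantization.reduction_surjective π hc p
  exact ⟨⟨_, quantAverage_mem π hc G a⟩, Subtype.ext (reduction_quantAverage π hc G hp)⟩

/-- The ideal here is generated by `ħ` inside `Q_ħ`, not inside `P_ħ`; `exists_eq_X_smul` is what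
makes the two agree on invariants. -/
lemma ker_invariantsReduction :
    RingHom.ker (invariantsReduction π hc G) = hIdeal k (quantInvariants π c hc G) := by
  ext a
  rw [RingHom.mem_ker, mem_hIdeal_iff]
  constructor
  · intro h
    exact exists_eq_X_smul π hc G a
      (Quantization.mem_hIdeal_of_reduction_eq_zero π hc (congrArg Subtype.val h))
  · rintro ⟨b, rfl⟩
    exact Subtype.ext (Quantization.reduction_X_smul π hc b)

/-- The isomorphism `Q_ħ / (ħ) ≃ Pᴳ` of algebras. -/
def quantInvariantsEquiv :
    (quantInvariants π c hc G ⧸ hIdeal k (quantInvariants π c hc G)) ≃ₐ[k]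
      classicalInvariants π G :=
  (Ideal.quotientEquivAlgOfEq k (ker_invariantsReduction π hc G).symm).trans
    (Ideal.quotientKerAlgEquivOfSurjective (invariantsReduction_surjective π hc G))

lemma quantInvariantsEquiv_mk (a : quantInvariants π c hc G) :
    quantInvariantsEquiv π hc G (Ideal.Quotient.mk _ a) = invariantsReduction π hc G a :=
  rfl

end Invariants

end Poly
end

theorem theorem0p2 {k : Type*} [Field k] [IsAlgClosed k] [CharZero k]
    (π : PoissonStructure k (MvPolynomial (Fin 3) k))
    (hquad : IsQuadratic π) (hunim : IsUnimodular π)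
    (c : Fin 3 → Fin 3 → Fin 3 → Fin 3 → k) (hc : HasCoeffs π c)
    (G : Subgroup (gradedPoissonAut π)) [Finite G] :
    Nonempty ((quantInvariants π c hc G ⧸ hIdeal k (quantInvariants π c hc G)) ≃ₐ[k]
      classicalInvariants π G) ∧
    (∀ f g : quantInvariants π c hc G, ∃ p : quantInvariants π c hc G,
      f * g - g * f = (PowerSeries.X : k⟦X⟧) • p) ∧
    ∃ β : PoissonStructure k
        (quantInvariants π c hc G ⧸ hIdeal k (quantInvariants π c hc G)),
      IsSemiclassicalLimit β ∧
      ∃ e : (quantInvariants π c hc G ⧸ hIdeal k (quantInvariants π c hc G)) ≃ₐ[k]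
          classicalInvariants π G,
        β.IsPoissonIso (classicalInvariantsPoisson π G) e := by
  refine ⟨⟨quantInvariantsEquiv π hc G⟩, fun f g => exists_eq_X_smul π hc G _ ?_,
    (classicalInvariantsPoisson π G).comap (quantInvariantsEquiv π hc G), ?_,
    quantInvariantsEquiv π hc G, PoissonStructure.comap_bracket _ _⟩
  · exact mem_hIdeal_iff.2 (Quantization.exists_commutator_eq _ _)
  -- After the isomorphism, the claim is an identity in `Pᴳ` valid for every admissible `p`, so
  -- independence of the choices needs no separate argument.
  · intro f g p h
    apply (quantInvariantsEquiv π hc G).injective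
    rw [PoissonStructure.comap_bracket]
    simp only [quantInvariantsEquiv_mk]
    exact Subtype.ext (Quantization.bracket_reduction π hc (congrArg Subtype.val h))
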